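/- Let $n\ge 1$, let $\mathbb{C}^n$ carry the inner product $\langle z,w\rangle=\sum_{j=1}^n z_j\overline{w_j}$ and the norm $\|z\|=\sqrt{\langle z,z\rangle}$, and let $\mathbb{B}^n=\{z\in\mathbb{C}^n:\|z\|<1\}$ and $\mathbb{D}=\mathbb{B}^1$. For a holomorphic map $f:\mathbb{B}^n\to\mathbb{C}^n$ let $J_f(z)=\left(\frac{\partial f_i}{\partial z_j}(z)\right)_{n\times n}$ be its complex Jacobian matrix. Let $-1\le A<B\le 1$ and $g(\zeta)=\frac{1+A\zeta}{1+B\zeta}$ for $\zeta\in\mathbb{D}$. Let $f:\mathbb{B}^n\to\mathbb{C}^n$ be a $g$-starlike mapping; that is, $f$ is holomorphic, $f(0)=0$, $J_f(0)=I_n$, $J_f(z)$ is nonsingular for every $z\in\mathbb{B}^n$, and the map $h(z)=[J_f(z)]^{-1}f(z)$ (which is then holomorphic with $h(0)=0$ and $J_h(0)=I_n$) satisfies $$\Big\langle h(z),\frac{z}{\|z\|^2}\Big\rangle\in g(\mathbb{D})\qquad\text{for all } z\in\mathbb{B}^n\setminus\{0\}.$$ (1) If $z\in\mathbb{B}^n\setminus\{0\}$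 satisfies $\|f(z)\|=\max_{\|\xi\|=\|z\|}\|f(\xi)\|$, then $$|\det J_f(z)|\le\begin{cases}(1+A\|z\|)^{\frac{n(B-A)}{A}}\left(\frac{1+B\|z\|}{1+A\|z\|}\right)^{\frac{n+1}{2}},&A\ne0,\\ e^{n(B-A)\|z\|}\left(\frac{1+B\|z\|}{1+A\|z\|}\right)^{\frac{n+1}{2}},&A=0,\end{cases}$$ and, for every $\delta\in\mathbb{C}^n$ with $\langle\delta,z\rangle=0$, $$\|J_f(z)\delta\|\le\begin{cases}(1+A\|z\|)^{\frac{B-A}{A}}\left(\frac{1+B\|z\|}{1+A\|z\|}\right)^{\frac12}\|\delta\|,&A\ne0,\\ e^{(B-A)\|z\|}\left(\frac{1+B\|z\|}{1+A\|z\|}\right)^{\frac12}\|\delta\|,&A=0.\end{cases}$$ (2) If $z\in\mathbb{B}^n\setminus\{0\}$ satisfies $\|f(z)\|=\min_{\|\xi\|=\|z\|}\|f(\xi)\|$, then $$|\det J_f(z)|\ge\begin{cases}(1-A\|z\|)^{\frac{n(A-B)}{-A}}\left(\frac{1-A\|z\|}{1-B\|z\|}\right)^{-\frac{n+1}{2}},&A\ne0,\\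 e^{n(A-B)\|z\|}\left(\frac{1-A\|z\|}{1-B\|z\|}\right)^{-\frac{n+1}{2}},&A=0,\end{cases}$$ and, for every $\delta\in\mathbb{C}^n$ with $\langle\delta,z\rangle=0$, $$\|J_f(z)\delta\|\ge\begin{cases}(1-A\|z\|)^{\frac{A-B}{-A}}\left(\frac{1-A\|z\|}{1-B\|z\|}\right)^{-\frac12}\|\delta\|,&A\ne0,\\ e^{(A-B)\|z\|}\left(\frac{1-A\|z\|}{1-B\|z\|}\right)^{-\frac12}\|\delta\|,&A=0.\end{cases}$$ -/

import Mathlib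

namespace GStarlike

/-- `ℂⁿ` with its Hermitian inner product and Euclidean norm. -/
abbrev Cn (n : ℕ) := EuclideanSpace ℂ (Fin n)

/-- The open unit ball `𝔹ⁿ` of `ℂⁿ`. -/
def unitBall (n : ℕ) : Set (Cn n) := Metric.ball 0 1

/-- `f ∈ H(𝔹ⁿ)`: holomorphic maps from the unit ball into `ℂⁿ`. Maps are represented by functions
on all of `ℂⁿ`; only their values on the ball are ever used. -/
def IsHolo {n : ℕ} (f : Cn n → Cn n) : Prop := DifferentiableOn ℂ f (unitBall n)

/-- `J_f(z)`, the complex derivative of `f` at `z`, as a linear operator on `ℂⁿ`; its matrix in the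
standard basis is the complex Jacobian matrix `(∂f_i/∂z_j (z))`. -/
noncomputable def J {n : ℕ} (f : Cn n → Cn n) (z : Cn n) : Cn n →L[ℂ] Cn n := fderiv ℂ f z

/-- Normalized: `f(0) = 0` and `J_f(0)` is the identity. -/
def IsNormalized {n : ℕ} (f : Cn n → Cn n) : Prop :=
  f 0 = 0 ∧ J f 0 = ContinuousLinearMap.id ℂ (Cn n)

/-- The class of normalized locally biholomorphic maps on `𝔹ⁿ`: holomorphic, normalized, and with
`J_f(z)` nonsingular at each point of the ball. -/
def LS (n : ℕ) : Set (Cn n → Cn n) :=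
  {f | IsHolo f ∧ IsNormalized f ∧ ∀ z ∈ unitBall n, (J f z).IsInvertible}

/-- The class `𝓜_g`. Mathlib's inner product is conjugate-linear in the first
variable, so the paper's `⟨h(z), z⟩ = ∑ h_j(z) conj(z_j)` is `inner ℂ z (h z)`. -/
def Mg (n : ℕ) (g : ℂ → ℂ) : Set (Cn n → Cn n) :=
  {h | IsHolo h ∧ IsNormalized h ∧
    ∀ z ∈ unitBall n, z ≠ 0 → inner ℂ z (h z) / ((‖z‖ ^ 2 : ℝ) : ℂ) ∈ g '' Metric.ball (0 : ℂ) 1}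

/-- The class of `g`-starlike maps on `𝔹ⁿ`: normalized locally biholomorphic maps `f` such that
`z ↦ J_f(z)⁻¹ f(z)` belongs to `𝓜_g`. -/
def StarlikeClass (n : ℕ) (g : ℂ → ℂ) : Set (Cn n → Cn n) :=
  {f | f ∈ LS n ∧ (fun z => (J f z).inverse (f z)) ∈ Mg n g}

/-- The function `ζ ↦ (1 + Aζ) / (1 + Bζ)`. -/
noncomputable def gAB (A B : ℝ) (ζ : ℂ) : ℂ := (1 + (A : ℂ) * ζ) / (1 + (B : ℂ) * ζ)

/-- The holomorphic tangent space at `z` to the sphere of radius `‖z‖`: all `w` with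
`∑ conj(z_j) w_j = 0`. -/
def holTangent {n : ℕ} (z : Cn n) : Set (Cn n) := {w | inner ℂ z w = 0}

end GStarlike

/-!
Let `z` be an extremal point of `‖f‖` on the sphere of radius `r = ‖z‖`, and let `M = ‖f z‖`.

By Lagrange multipliers `Df(z)† f(z) = μ z` for a real `μ`
(`exists_multiplier_of_isExtrOn_sphere`). Pairing with `h(z) = Df(z)⁻¹ f(z)` gives
`M² = μ ⟨h(z), z⟩`, and the Schwarz lemma for `g⁻¹(⟨h(z), z⟩ / r²)` shows that
`λ = μ r² / M²` lies between `(1 - B r) / (1 - A r)` and `(1 + B r) / (1 + A r)`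
(`StarlikeClass.multiplier_bounds`).

The number `λ` is also the logarithmic radial derivative `r ∂ᵣ log ‖f‖` at `z`. Integrating the
bounds on it along the extremal points of all smaller spheres bounds `M / r` by the exponential of
`logGrowth`; this is done by a maximum principle that needs no differentiability of
`r ↦ max ‖f‖` (`LS.log_norm_div_norm_le`).

The second-order condition at a maximum, taken along the directions `δ` and `i δ` together so that
the second derivative of `f` cancels, is `‖Df(z) δ‖² ≤ μ ‖δ‖²` for `δ ⊥ z`, with the reverse
inequality at a minimum (`norm_fderiv_sq_le_of_isMaxOn_sphere`,
`le_norm_fderiv_sq_of_isMinOn_sphere`). As `√μ = √λ M / r`, this is the bound on tangent vectors.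
Since `Df(z)` maps `z⊥` to `f(z)⊥` and the component along `f(z)` of its derivative in the direction
of `z` is known, it also bounds the determinant by `√μ ^ (n + 1) r / M = λ ^ ((n + 1) / 2) (M / r) ^ n`
(`norm_det_mul_norm_le`, `le_norm_det_mul_norm`).
-/

namespace GStarlike

open Filter Topology Metric

/-! ### Strict differentiability of holomorphic maps -/

/-- A holomorphic map between complex normed spaces is strictly differentiable. On small balls
`f - Df(z)` oscillates by `o(radius)`, so by the Schwarz lemma it is Lipschitz there with a small
constant; this avoids both analyticity in several variables and continuity of `Df`. -/
theorem hasStrictFDerivAt_of_eventually_differentiableAt {E F : Type*}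
    [NormedAddCommGroup E] [NormedSpace ℂ E] [NormedAddCommGroup F] [NormedSpace ℂ F]
    {f : E → F} {z : E} (hf : ∀ᶠ w in 𝓝 z, DifferentiableAt ℂ f w) :
    HasStrictFDerivAt f (fderiv ℂ f z) z := by
  refine .of_isLittleO ?_
  rw [Asymptotics.isLittleO_iff]
  intro ε hε
  have h1 := hasFDerivAt_iff_isLittleO.1 hf.self_of_nhds.hasFDerivAt
  rw [Asymptotics.isLittleO_iff] at h1
  have h2 := h1 (show 0 < ε / 4 by positivity)
  obtain ⟨R, hR, hball⟩ := Metric.eventually_nhds_iff_ball.1 (hf.and h2)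
  set k : E → F := fun x => f x - fderiv ℂ f z x with hk
  have hkz : ∀ x ∈ ball z R, ‖k x - k z‖ ≤ ε / 4 * R := by
    intro x hx
    have h3 := (hball x hx).2
    have : k x - k z = f x - f z - fderiv ℂ f z (x - z) := by simp [hk]; abel
    rw [this]
    refine h3.trans ?_
    have : ‖x - z‖ < R := by simpa [dist_eq_norm] using hx
    gcongr
  have hd : DifferentiableOn ℂ k (ball z R) := fun x hx =>
    ((hball x hx).1.sub (fderiv ℂ f z).differentiableAt).differentiableWithinAt
  have hN : ball z (R / 4) ×ˢ ball z (R / 4) ∈ 𝓝 (z, z) :=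
    prod_mem_nhds (ball_mem_nhds _ (by positivity)) (ball_mem_nhds _ (by positivity))
  filter_upwards [hN] with p hp
  obtain ⟨hx, hy⟩ := hp
  have hsub : ball p.2 (R / 2) ⊆ ball z R :=
    ball_subset_ball' (by have := mem_ball.1 hy; linarith)
  have hmaps : Set.MapsTo k (ball p.2 (R / 2)) (closedBall (k p.2) (ε / 2 * R)) := by
    intro x hx
    have e1 := hkz x (hsub hx)
    have e2 := hkz p.2 (hsub (mem_ball_self (by positivity)))
    rw [mem_closedBall, dist_eq_norm]
    calc ‖k x - k p.2‖ = ‖(k x - k z) - (k p.2 - k z)‖ := by congr 1; abel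
      _ ≤ _ := (norm_sub_le _ _).trans (by linarith)
  have hx' : p.1 ∈ ball p.2 (R / 2) := by
    have a := mem_ball.1 hx
    have b := mem_ball'.1 hy
    have := dist_triangle p.1 z p.2
    rw [mem_ball]; linarith
  have := Complex.dist_le_div_mul_dist_of_mapsTo_ball (hd.mono hsub) hmaps hx'
  rw [dist_eq_norm, dist_eq_norm] at this
  have e : ε / 2 * R / (R / 2) = ε := by field_simp
  rw [e] at this
  convert this using 2
  simp [hk]; abel

/-! ### Determinants of operators with norm bounds -/

section Det

variable {E : Type*} [NormedAddCommGroup E] [InnerProductSpace ℂ E] [FiniteDimensional ℂ E]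

/-- The unit vectors are the eigenvectors of `T† T`, for which `‖T v‖ ^ 2` is the eigenvalue. -/
theorem norm_det_sq_eq_prod (T : E →ₗ[ℂ] E) :
    ∃ v : Fin (Module.finrank ℂ E) → E, (∀ i, ‖v i‖ = 1) ∧ ‖T.det‖ ^ 2 = ∏ i, ‖T (v i)‖ ^ 2 := by
  have hT := T.isSymmetric_adjoint_mul_self
  refine ⟨hT.eigenvectorBasis rfl, fun i => (hT.eigenvectorBasis rfl).orthonormal.1 i, ?_⟩
  have h1 := T.normDet_sq
  have h2 := hT.det_eq_prod_eigenvalues rfl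
  rw [T.normDet_eq_norm_det] at h1
  have h3 : ∀ i, hT.eigenvalues rfl i = ‖T (hT.eigenvectorBasis rfl i)‖ ^ 2 := by
    intro i
    have := hT.apply_eigenvectorBasis rfl i
    have e : inner ℂ (hT.eigenvectorBasis rfl i)
      ((LinearMap.adjoint T * T) (hT.eigenvectorBasis rfl i)) = (hT.eigenvalues rfl i : ℂ) := by
      rw [this, inner_smul_right, inner_self_eq_norm_sq_to_K]
      simp [(hT.eigenvectorBasis rfl).orthonormal.1 i]
    rw [Module.End.mul_apply, LinearMap.adjoint_inner_right, inner_self_eq_norm_sq_to_K] at e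
    exact Complex.ofReal_injective (by simpa using e.symm)
  rw [← Finset.prod_congr rfl fun i _ => h3 i]
  have : ((‖T.det‖ ^ 2 : ℝ) : ℂ) = ((∏ i, hT.eigenvalues rfl i : ℝ) : ℂ) := by
    rw [Complex.ofReal_prod]
    exact h1.trans h2
  exact_mod_cast this

theorem norm_det_le_pow {T : E →ₗ[ℂ] E} {c : ℝ} (hc : 0 ≤ c) (h : ∀ x, ‖T x‖ ≤ c * ‖x‖) :
    ‖T.det‖ ≤ c ^ Module.finrank ℂ E := by
  obtain ⟨v, hv, hp⟩ := norm_det_sq_eq_prod T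
  refine le_of_sq_le_sq ?_ (by positivity)
  rw [hp, ← pow_mul, mul_comm, pow_mul]
  calc _ ≤ ∏ i : Fin (Module.finrank ℂ E), c ^ 2 :=
        Finset.prod_le_prod (fun i _ => by positivity) fun i _ => by
          have := h (v i)
          rw [hv, mul_one] at this
          gcongr
    _ = (c ^ 2) ^ Module.finrank ℂ E := by simp

theorem pow_le_norm_det {T : E →ₗ[ℂ] E} {c : ℝ} (hc : 0 ≤ c) (h : ∀ x, c * ‖x‖ ≤ ‖T x‖) :
    c ^ Module.finrank ℂ E ≤ ‖T.det‖ := by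
  obtain ⟨v, hv, hp⟩ := norm_det_sq_eq_prod T
  refine le_of_sq_le_sq ?_ (by positivity)
  rw [hp, ← pow_mul, mul_comm, pow_mul]
  calc (c ^ 2) ^ Module.finrank ℂ E = ∏ i : Fin (Module.finrank ℂ E), c ^ 2 := by simp
    _ ≤ _ := Finset.prod_le_prod (fun i _ => by positivity) fun i _ => by
        have := h (v i)
        rw [hv, mul_one] at this
        gcongr

/-- The hypothesis on `T` says `T† w = μ z`, so `T` maps `z⊥` into `w⊥`. Precomposing with a
transvection yields `S` that agrees with `T` on `z⊥` and maps the direction of `z` to the direction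
of `w`, stretched by `√μ`. Thus `S` respects the two orthogonal decompositions, while its
determinant differs from that of `T` by a known factor. -/
theorem exists_orthogonal_modification {T : E →ₗ[ℂ] E} {w z a : E} {μ : ℝ} (hμ : 0 < μ)
    (hz : z ≠ 0) (hw : w ≠ 0) (ha : T a = w) (h : ∀ v, inner ℂ w (T v) = μ * inner ℂ z v) :
    ∃ S : E →ₗ[ℂ] E, ‖S.det‖ = ‖T.det‖ * (‖w‖ / (√μ * ‖z‖)) ∧
      ∀ x, ∃ δ, inner ℂ z δ = 0 ∧ ∃ b : ℝ, 0 ≤ b ∧ ‖x‖ ^ 2 = ‖δ‖ ^ 2 + b ∧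
        ‖S x‖ ^ 2 = ‖T δ‖ ^ 2 + μ * b := by
  have hz' : (‖z‖ : ℂ) ≠ 0 := by simpa using hz
  have hw' : (‖w‖ : ℂ) ≠ 0 := by simpa using hw
  have hc : (√μ : ℂ) ≠ 0 := by simpa using (Real.sqrt_pos.2 hμ).ne'
  have hcc : (√μ : ℂ) ^ 2 = μ := by exact_mod_cast Real.sq_sqrt hμ.le
  set u : E := (‖z‖ : ℂ)⁻¹ • z with hu
  have huz : ∀ v, inner ℂ u v = (‖z‖ : ℂ)⁻¹ * inner ℂ z v := by
    intro v; simp [hu, mul_comm]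
  have hun : ‖u‖ = 1 := by simp [hu, norm_smul, hz]
  have hzz : inner ℂ z z = (‖z‖ : ℂ) ^ 2 := inner_self_eq_norm_sq_to_K z
  have hww : inner ℂ w w = (‖w‖ : ℂ) ^ 2 := inner_self_eq_norm_sq_to_K w
  have hza : (‖w‖ : ℂ) ^ 2 = μ * inner ℂ z a := by rw [← hww, ← h, ha]
  -- with this `y`, `T (u + y)` is the multiple of `w` of norm `√μ`
  let y : E := ((√μ : ℂ) / ‖w‖) • a - u
  have hdet : 1 + inner ℂ u y = (‖w‖ : ℂ) / (√μ * ‖z‖) := by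
    have e : inner ℂ u u = 1 := by
      rw [inner_self_eq_norm_sq_to_K, hun]; simp
    rw [inner_sub_right, e, inner_smul_right, huz]
    rw [← hcc] at hza
    field_simp
    linear_combination -hza
  refine ⟨T ∘ₗ LinearMap.transvection (innerₛₗ ℂ u) y, ?_, fun x => ?_⟩
  · rw [LinearMap.det_comp, LinearMap.transvection.det, norm_mul]
    congr 1
    rw [innerₛₗ_apply_apply, hdet]
    simp [abs_of_nonneg (Real.sqrt_nonneg μ)]
  · set t : ℂ := inner ℂ u x with ht
    have hδ : inner ℂ u (x - t • u) = 0 := by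
      rw [inner_sub_right, inner_smul_right, inner_self_eq_norm_sq_to_K, hun, ← ht]; simp
    have hzδ : inner ℂ z (x - t • u) = 0 := by
      rw [huz] at hδ
      simpa [hz] using hδ
    refine ⟨x - t • u, hzδ, ‖t‖ ^ 2, by positivity, ?_, ?_⟩
    · have := norm_add_sq_eq_norm_sq_add_norm_sq_of_inner_eq_zero (𝕜 := ℂ) (x - t • u) (t • u)
        (by rw [inner_smul_right, ← inner_conj_symm, hδ]; simp)
      rw [sub_add_cancel, norm_smul, hun, mul_one] at this
      simpa [sq] using this
    · have e : (T ∘ₗ LinearMap.transvection (innerₛₗ ℂ u) y) x =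
          T (x - t • u) + (t * (√μ / ‖w‖)) • w := by
        simp only [LinearMap.comp_apply, LinearMap.transvection.apply, innerₛₗ_apply_apply, ← ht, y,
          ← ha, ← map_smul, ← map_add]
        congr 1
        module
      have h0 : inner ℂ (T (x - t • u)) ((t * (√μ / ‖w‖)) • w) = 0 := by
        rw [inner_smul_right, ← inner_conj_symm, h, hzδ]; simp
      have := norm_add_sq_eq_norm_sq_add_norm_sq_of_inner_eq_zero (𝕜 := ℂ) _ _ h0
      rw [e, sq, this, norm_smul, norm_mul, norm_div]
      have hw2 : ‖w‖ ≠ 0 := by simpa using hw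
      have hs := Real.sq_sqrt hμ.le
      simp only [Complex.norm_real, abs_norm, Real.norm_eq_abs, abs_of_nonneg (Real.sqrt_nonneg μ)]
      field_simp
      rw [hs]

theorem norm_det_mul_norm_le {T : E →ₗ[ℂ] E} {w z a : E} {μ : ℝ} (hμ : 0 < μ)
    (hz : z ≠ 0) (hw : w ≠ 0) (ha : T a = w) (h : ∀ v, inner ℂ w (T v) = μ * inner ℂ z v)
    (hT : ∀ δ, inner ℂ z δ = 0 → ‖T δ‖ ^ 2 ≤ μ * ‖δ‖ ^ 2) :
    ‖T.det‖ * ‖w‖ ≤ √μ ^ (Module.finrank ℂ E + 1) * ‖z‖ := by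
  obtain ⟨S, hS, hx⟩ := exists_orthogonal_modification hμ hz hw ha h
  have := norm_det_le_pow (T := S) (Real.sqrt_nonneg μ) fun x => by
    obtain ⟨δ, hδ, b, hb, e1, e2⟩ := hx x
    refine le_of_sq_le_sq ?_ (by positivity)
    rw [mul_pow, Real.sq_sqrt hμ.le, e1, e2]
    linarith [hT δ hδ]
  have hz' : 0 < ‖z‖ := norm_pos_iff.2 hz
  rw [hS, mul_div_assoc', div_le_iff₀ (by positivity)] at this
  rw [pow_succ]; linarith

theorem le_norm_det_mul_norm {T : E →ₗ[ℂ] E} {w z a : E} {μ : ℝ} (hμ : 0 < μ)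
    (hz : z ≠ 0) (hw : w ≠ 0) (ha : T a = w) (h : ∀ v, inner ℂ w (T v) = μ * inner ℂ z v)
    (hT : ∀ δ, inner ℂ z δ = 0 → μ * ‖δ‖ ^ 2 ≤ ‖T δ‖ ^ 2) :
    √μ ^ (Module.finrank ℂ E + 1) * ‖z‖ ≤ ‖T.det‖ * ‖w‖ := by
  obtain ⟨S, hS, hx⟩ := exists_orthogonal_modification hμ hz hw ha h
  have := pow_le_norm_det (T := S) (Real.sqrt_nonneg μ) fun x => by
    obtain ⟨δ, hδ, b, hb, e1, e2⟩ := hx x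
    refine le_of_sq_le_sq ?_ (by positivity)
    rw [mul_pow, Real.sq_sqrt hμ.le, e1, e2]
    linarith [hT δ hδ]
  have hz' : 0 < ‖z‖ := norm_pos_iff.2 hz
  rw [hS, mul_div_assoc', le_div_iff₀ (by positivity)] at this
  rw [pow_succ]; linarith

end Det

/-! ### Extrema of the norm on a sphere -/

section Sphere

variable {E F : Type*} [NormedAddCommGroup E] [InnerProductSpace ℂ E]
  [NormedAddCommGroup F] [InnerProductSpace ℂ F] {f : E → F} {z : E}

/-- The Lagrange multiplier rule: at an extremum `z` of `‖f‖` on a sphere about `0`,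
`Df(z)† f(z) = μ z` with `μ` real. The rule itself gives only the equality of real parts; applying
it to `v` and `i v` gives the complex one. -/
theorem exists_multiplier_of_isExtrOn_sphere [CompleteSpace E]
    (hf : ∀ᶠ w in 𝓝 z, DifferentiableAt ℂ f w) (hz : z ≠ 0)
    (hext : IsExtrOn (fun ξ => ‖f ξ‖) (sphere 0 ‖z‖) z) :
    ∃ μ : ℝ, ∀ v, inner ℂ (f z) (fderiv ℂ f z v) = μ * inner ℂ z v := by
  have hset : sphere (0 : E) ‖z‖ = {x | ‖x‖ ^ 2 = ‖z‖ ^ 2} := by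
    ext x; simp
  have hext' : IsExtrOn (fun ξ => ‖f ξ‖ ^ 2) {x | ‖x‖ ^ 2 = ‖z‖ ^ 2} z := by
    rw [← hset]
    refine hext.imp (fun h => ?_) (fun h => ?_)
    all_goals
      intro x hx
      have := h hx
      simp only [Set.mem_ofPred_eq] at this ⊢
      gcongr
  let _ : InnerProductSpace ℝ E := InnerProductSpace.rclikeToReal ℂ E
  let _ : InnerProductSpace ℝ F := InnerProductSpace.rclikeToReal ℂ F
  have h1 : HasStrictFDerivAt (fun ξ => ‖f ξ‖ ^ 2)
      (2 • (innerSL ℝ (f z)).comp ((fderiv ℂ f z).restrictScalars ℝ)) z :=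
    (hasStrictFDerivAt_norm_sq (f z)).comp z
      ((hasStrictFDerivAt_of_eventually_differentiableAt hf).restrictScalars ℝ)
  have h2 := hasStrictFDerivAt_norm_sq z
  obtain ⟨a, b, hab, heq⟩ := hext'.localize.exists_multipliers_of_hasStrictFDerivAt_1d h2 h1
  have key : ∀ v, a * (inner ℂ z v).re + b * (inner ℂ (f z) (fderiv ℂ f z v)).re = 0 := by
    intro v
    have := DFunLike.congr_fun heq v
    simp [real_inner_eq_re_inner ℂ] at this
    linarith
  have hb : b ≠ 0 := by
    rintro rfl
    have := key z
    have ha : a ≠ 0 := by simpa using hab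
    have e : (inner ℂ z z).re = ‖z‖ ^ 2 := inner_self_eq_norm_sq (𝕜 := ℂ) z
    rw [e] at this
    simp [ha, hz] at this
  refine ⟨-a / b, fun v => ?_⟩
  have k1 := key v
  have k2 := key (Complex.I • v)
  rw [map_smul, inner_smul_right, inner_smul_right] at k2
  simp at k2
  apply Complex.ext
  · rw [Complex.re_ofReal_mul]; field_simp; linarith
  · rw [Complex.im_ofReal_mul]; field_simp; linarith

/-- Second-order expansion of `‖f‖ ^ 2` along the curve `s ↦ √(1 - s²) z + s ω δ`. The constant `κ`
stands for the contribution of the second derivative of `f`; it enters with the factor `ω ^ 2`, and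
so cancels between `ω = 1` and `ω = i`. -/
theorem exists_tendsto_second_difference
    (hf : ∀ᶠ w in 𝓝 z, DifferentiableAt ℂ f w) {μ : ℝ}
    (hμ : ∀ v, inner ℂ (f z) (fderiv ℂ f z v) = μ * inner ℂ z v) {δ : E} (hδ : inner ℂ z δ = 0) :
    ∃ κ : ℂ, ∀ ω : ℂ, ω ≠ 0 → Tendsto (fun s : ℝ =>
        (‖f ((√(1 - s ^ 2) : ℂ) • z + (s * ω) • δ)‖ ^ 2 - ‖f z‖ ^ 2) / s ^ 2) (𝓝[≠] 0)
      (𝓝 (‖ω‖ ^ 2 * ‖fderiv ℂ f z δ‖ ^ 2 + 2 * (ω ^ 2 * κ).re - μ * ‖z‖ ^ 2)) := by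
  have hJδ : inner ℂ (f z) (fderiv ℂ f z δ) = 0 := by rw [hμ, hδ, mul_zero]
  have hst := hasStrictFDerivAt_of_eventually_differentiableAt hf
  -- the scalar function `q(ζ) = ⟨f(z + ζδ) - f z, f z⟩` vanishes to second order at `0`
  let q : ℂ → ℂ := fun ζ => inner ℂ (f z) (f (z + ζ • δ) - f z)
  have hline : ∀ ζ : ℂ, HasDerivAt (fun ζ : ℂ => z + ζ • δ) δ ζ := fun ζ => by
    simpa using ((hasDerivAt_id ζ).smul_const δ).const_add z
  have hcont : Tendsto (fun ζ : ℂ => z + ζ • δ) (𝓝 0) (𝓝 z) := by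
    simpa using (hline 0).continuousAt.tendsto
  have hq : ∀ᶠ ζ in 𝓝 (0 : ℂ), DifferentiableAt ℂ q ζ := by
    filter_upwards [hcont.eventually hf] with ζ h
    exact (innerSL ℂ (f z)).differentiableAt.comp ζ
      ((h.comp ζ (hline ζ).differentiableAt).sub_const _)
  have hq0 : q 0 = 0 := by simp [q]
  have hfz : HasFDerivAt f (fderiv ℂ f z) (z + (0 : ℂ) • δ) := by
    simpa using hst.hasFDerivAt
  have hq1 : HasDerivAt q 0 0 := by
    have := (innerSL ℂ (f z)).hasFDerivAt.comp_hasDerivAt 0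
      ((hfz.comp_hasDerivAt 0 (hline 0)).sub_const (f z))
    rw [innerSL_apply_apply, hJδ] at this
    exact this
  obtain ⟨R, hR, hqR⟩ := Metric.eventually_nhds_iff_ball.1 hq
  have hds : DifferentiableAt ℂ (dslope q 0) 0 :=
    ((Complex.differentiableOn_dslope (ball_mem_nhds 0 hR)).2
      fun ζ hζ => (hqR ζ hζ).differentiableWithinAt).differentiableAt (ball_mem_nhds 0 hR)
  refine ⟨deriv (dslope q 0) 0, fun ω hω => ?_⟩
  have hκ : Tendsto (fun ζ => q ζ / ζ ^ 2) (𝓝[≠] 0) (𝓝 (deriv (dslope q 0) 0)) := by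
    refine (hasDerivAt_iff_tendsto_slope.1 hds.hasDerivAt).congr' ?_
    filter_upwards [self_mem_nhdsWithin] with ζ hζ
    have hζ : ζ ≠ 0 := hζ
    rw [slope_def_field, dslope_same, hq1.deriv, dslope_of_ne _ hζ, slope_def_field, hq0]
    field_simp
    ring
  -- `c` is the curve, `l` its tangent line, and `c s - l s ~ -(s² / 2) z`
  let c : ℝ → E := fun s => (√(1 - s ^ 2) : ℂ) • z + (s * ω) • δ
  let l : ℝ → E := fun s => z + (s * ω) • δ
  have hsω : Tendsto (fun s : ℝ => (s : ℂ) * ω) (𝓝[≠] 0) (𝓝[≠] 0) := by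
    refine tendsto_nhdsWithin_iff.2 ⟨?_, ?_⟩
    · refine Tendsto.mono_left ?_ nhdsWithin_le_nhds
      have : Continuous fun s : ℝ => (s : ℂ) * ω := by fun_prop
      simpa using this.tendsto 0
    · filter_upwards [self_mem_nhdsWithin] with s hs
      have : s ≠ 0 := hs
      simp [this, hω]
  have hl : Tendsto l (𝓝[≠] 0) (𝓝 z) :=
    hcont.comp (hsω.mono_right nhdsWithin_le_nhds)
  have hc : Tendsto c (𝓝[≠] 0) (𝓝 z) := by
    have : Continuous c := by fun_prop
    have := this.tendsto 0
    simp only [c] at this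
    simp at this
    exact this.mono_left nhdsWithin_le_nhds
  have hsq : ∀ᶠ s : ℝ in 𝓝[≠] 0, s ≠ 0 ∧ 0 < 1 - s ^ 2 := by
    filter_upwards [self_mem_nhdsWithin,
      nhdsWithin_le_nhds (ball_mem_nhds (0 : ℝ) one_pos)] with s hs hs1
    have : |s| < 1 := by simpa using hs1
    exact ⟨hs, by have := (sq_lt_one_iff_abs_lt_one s).2 this; linarith⟩
  have hcl : ∀ᶠ s : ℝ in 𝓝[≠] 0, (s ^ 2)⁻¹ • (c s - l s) = (-(1 + √(1 - s ^ 2))⁻¹ : ℝ) • z := by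
    filter_upwards [hsq] with s ⟨hs, hs1⟩
    have e : c s - l s = (√(1 - s ^ 2) - 1 : ℝ) • z := by
      simp only [c, l]
      rw [← Complex.coe_smul (√(1 - s ^ 2) - 1 : ℝ)]
      push_cast
      module
    rw [e, smul_smul]
    congr 1
    have : 0 < √(1 - s ^ 2) := Real.sqrt_pos.2 hs1
    have h2 := Real.sq_sqrt hs1.le
    field_simp
    linear_combination h2
  have hclt : Tendsto (fun s : ℝ => (s ^ 2)⁻¹ • (c s - l s)) (𝓝[≠] 0) (𝓝 ((-(1 / 2) : ℝ) • z)) := by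
    refine Tendsto.congr' (EventuallyEq.symm hcl) (Tendsto.smul_const ?_ z)
    have : ContinuousAt (fun s : ℝ => -(1 + √(1 - s ^ 2))⁻¹) 0 := by
      refine (ContinuousAt.inv₀ (by fun_prop) ?_).neg
      simp
    have := this.tendsto
    norm_num at this ⊢
    exact this.mono_left nhdsWithin_le_nhds
  -- `(f (c s) - f (l s)) / s² → -½ Df(z) z`, by strict differentiability
  have h1 : Tendsto (fun s : ℝ => (s ^ 2)⁻¹ • (f (c s) - f (l s))) (𝓝[≠] 0)
      (𝓝 ((-(1 / 2) : ℝ) • fderiv ℂ f z z)) := by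
    have ho := hst.isLittleO.comp_tendsto (hc.prodMk_nhds hl)
    have hO : (fun s : ℝ => c s - l s) =O[𝓝[≠] 0] fun s : ℝ => s ^ 2 := by
      refine Asymptotics.IsBigO.trans (g := fun s : ℝ => (s ^ 2 : ℝ) • ((s ^ 2)⁻¹ • (c s - l s))) ?_ ?_
      · refine EventuallyEq.isBigO ?_
        filter_upwards [hsq] with s ⟨hs, _⟩
        rw [smul_smul, mul_inv_cancel₀ (by positivity), one_smul]
      · simpa using (Asymptotics.isBigO_refl (fun s : ℝ => s ^ 2) (𝓝[≠] 0)).smul (hclt.isBigO_one ℝ)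
    have h3 := (ho.trans_isBigO hO)
    have h4 : Tendsto (fun s : ℝ => (s ^ 2)⁻¹ • (f (c s) - f (l s) - fderiv ℂ f z (c s - l s)))
        (𝓝[≠] 0) (𝓝 0) := by
      rw [← Asymptotics.isLittleO_one_iff ℝ]
      have := (Asymptotics.isBigO_refl (fun s : ℝ => (s ^ 2)⁻¹) (𝓝[≠] 0)).smul_isLittleO h3
      refine this.trans_isBigO ?_
      refine EventuallyEq.isBigO ?_
      filter_upwards [hsq] with s ⟨hs, _⟩
      simp [hs]
    have h5 := ((fderiv ℂ f z).continuous.tendsto _).comp hclt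
    have h6 := h4.add h5
    rw [zero_add] at h6
    have e : fderiv ℂ f z ((-(1 / 2) : ℝ) • z) = (-(1 / 2) : ℝ) • fderiv ℂ f z z :=
      (fderiv ℂ f z).map_smul_of_tower _ _
    rw [e] at h6
    refine h6.congr fun s => ?_
    simp only [Function.comp_apply]
    rw [(fderiv ℂ f z).map_smul_of_tower ((s ^ 2)⁻¹ : ℝ), ← smul_add]
    simp
  have h2 : Tendsto (fun s : ℝ => s⁻¹ • (f (l s) - f z)) (𝓝[≠] 0) (𝓝 (ω • fderiv ℂ f z δ)) := by
    have := (hasDerivAt_iff_tendsto_slope.1 (hfz.comp_hasDerivAt 0 (hline 0))).comp hsω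
    refine (this.const_smul ω).congr' ?_
    filter_upwards [hsq] with s ⟨hs, _⟩
    simp only [Function.comp_apply, slope_def_module, l]
    rw [← Complex.coe_smul, smul_smul]
    simp [hω]
  have h3 : Tendsto (fun s : ℝ => s⁻¹ • (f (c s) - f z)) (𝓝[≠] 0) (𝓝 (ω • fderiv ℂ f z δ)) := by
    have hs0 : Tendsto (fun s : ℝ => s) (𝓝[≠] 0) (𝓝 0) := tendsto_id.mono_left nhdsWithin_le_nhds
    have := (hs0.smul h1).add h2
    rw [zero_smul, zero_add] at this
    refine this.congr' ?_
    filter_upwards [hsq] with s ⟨hs, _⟩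
    rw [smul_smul, show s * (s ^ 2)⁻¹ = s⁻¹ by field_simp, ← smul_add]
    simp
  have h4 : Tendsto (fun s : ℝ => ω ^ 2 * (q (s * ω) / (s * ω) ^ 2)) (𝓝[≠] 0)
      (𝓝 (ω ^ 2 * deriv (dslope q 0) 0)) := (hκ.comp hsω).const_mul _
  have h5 : Tendsto (fun s : ℝ => inner ℂ (f z) ((s ^ 2)⁻¹ • (f (c s) - f (l s)))) (𝓝[≠] 0)
      (𝓝 (inner ℂ (f z) ((-(1 / 2) : ℝ) • fderiv ℂ f z z))) := tendsto_const_nhds.inner h1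
  have h6 := (h3.norm.pow 2).add
    ((Complex.continuous_re.tendsto _ |>.comp (h4.add h5)).const_mul 2)
  have hlim : ‖ω • fderiv ℂ f z δ‖ ^ 2 + 2 * (ω ^ 2 * deriv (dslope q 0) 0 +
      inner ℂ (f z) ((-(1 / 2) : ℝ) • fderiv ℂ f z z)).re =
      ‖ω‖ ^ 2 * ‖fderiv ℂ f z δ‖ ^ 2 + 2 * (ω ^ 2 * deriv (dslope q 0) 0).re - μ * ‖z‖ ^ 2 := by
    rw [norm_smul, mul_pow, Complex.add_re, ← Complex.coe_smul, inner_smul_right, hμ,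
      Complex.re_ofReal_mul, Complex.re_ofReal_mul]
    have e : (inner ℂ z z).re = ‖z‖ ^ 2 := inner_self_eq_norm_sq (𝕜 := ℂ) z
    rw [e]
    ring
  rw [← hlim]
  refine h6.congr' ?_
  filter_upwards [hsq] with s ⟨hs, _⟩
  have e1 : ‖f (c s)‖ ^ 2 = ‖f z‖ ^ 2 + 2 * (inner ℂ (f z) (f (c s) - f z)).re
      + ‖f (c s) - f z‖ ^ 2 := by
    have := norm_add_sq (𝕜 := ℂ) (f z) (f (c s) - f z)
    rwa [add_sub_cancel] at this
  have e2 : ω ^ 2 * (q (s * ω) / (s * ω) ^ 2) + inner ℂ (f z) ((s ^ 2)⁻¹ • (f (c s) - f (l s))) =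
      ((s ^ 2)⁻¹ : ℝ) * inner ℂ (f z) (f (c s) - f z) := by
    rw [← Complex.coe_smul, inner_smul_right]
    have : f (c s) - f z = (f (l s) - f z) + (f (c s) - f (l s)) := by abel
    have hs' : (s : ℂ) ≠ 0 := by exact_mod_cast hs
    rw [this, inner_add_right, mul_add]
    simp only [q, l]
    push_cast
    field_simp
  simp only [Function.comp_apply]
  rw [e2, norm_smul, Complex.re_ofReal_mul, mul_pow]
  change _ = (‖f (c s)‖ ^ 2 - ‖f z‖ ^ 2) / s ^ 2
  rw [e1]
  simp
  field_simp
  ring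

theorem curve_mem_sphere {δ : E} (hδ : inner ℂ z δ = 0) (hn : ‖δ‖ = ‖z‖) {ω : ℂ} (hω : ‖ω‖ = 1)
    {s : ℝ} (hs : s ^ 2 ≤ 1) : (√(1 - s ^ 2) : ℂ) • z + (s * ω) • δ ∈ sphere (0 : E) ‖z‖ := by
  have h0 : inner ℂ ((√(1 - s ^ 2) : ℂ) • z) ((s * ω) • δ) = 0 := by
    rw [inner_smul_left, inner_smul_right, hδ, mul_zero, mul_zero]
  have := norm_add_sq_eq_norm_sq_add_norm_sq_of_inner_eq_zero (𝕜 := ℂ) _ _ h0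
  rw [mem_sphere_zero_iff_norm, ← sq_eq_sq₀ (norm_nonneg _) (norm_nonneg _), sq, this,
    norm_smul, norm_smul, norm_mul, hn, hω, Complex.norm_real, Complex.norm_real, Real.norm_eq_abs,
    Real.norm_eq_abs]
  have h1 : |√(1 - s ^ 2)| ^ 2 = 1 - s ^ 2 := by rw [sq_abs, Real.sq_sqrt (by linarith)]
  have h2 := sq_abs s
  linear_combination ‖z‖ ^ 2 * h1 + ‖z‖ ^ 2 * h2

/-- The curves are those of `exists_tendsto_second_difference` for `ω = 1` and `ω = i`; in the sum
the second derivative of `f` drops out. -/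
theorem exists_tendsto_symmetrized_difference (hf : ∀ᶠ w in 𝓝 z, DifferentiableAt ℂ f w) {μ : ℝ}
    (hμ : ∀ v, inner ℂ (f z) (fderiv ℂ f z v) = μ * inner ℂ z v) {δ : E} (hδ : inner ℂ z δ = 0)
    (hn : ‖δ‖ = ‖z‖) :
    ∃ c₁ c₂ : ℝ → E, (∀ s, s ^ 2 ≤ 1 → c₁ s ∈ sphere 0 ‖z‖ ∧ c₂ s ∈ sphere 0 ‖z‖) ∧
      Tendsto (fun s => (‖f (c₁ s)‖ ^ 2 - ‖f z‖ ^ 2) / s ^ 2 + (‖f (c₂ s)‖ ^ 2 - ‖f z‖ ^ 2) / s ^ 2)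
        (𝓝[≠] 0) (𝓝 (2 * (‖fderiv ℂ f z δ‖ ^ 2 - μ * ‖δ‖ ^ 2))) := by
  obtain ⟨κ, hκ⟩ := exists_tendsto_second_difference hf hμ hδ
  refine ⟨_, _, fun s hs => ⟨curve_mem_sphere hδ hn (ω := 1) (by simp) hs,
    curve_mem_sphere hδ hn (ω := Complex.I) (by simp) hs⟩, ?_⟩
  convert (hκ 1 one_ne_zero).add (hκ Complex.I Complex.I_ne_zero) using 2
  simp [hn]
  ring

theorem norm_fderiv_sq_le_of_isMaxOn_sphere (hf : ∀ᶠ w in 𝓝 z, DifferentiableAt ℂ f w) {μ : ℝ}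
    (hμ : ∀ v, inner ℂ (f z) (fderiv ℂ f z v) = μ * inner ℂ z v) (hz : z ≠ 0)
    (hmax : IsMaxOn (fun ξ => ‖f ξ‖) (sphere 0 ‖z‖) z) {δ : E} (hδ : inner ℂ z δ = 0) :
    ‖fderiv ℂ f z δ‖ ^ 2 ≤ μ * ‖δ‖ ^ 2 := by
  wlog hn : ‖δ‖ = ‖z‖ generalizing δ
  · rcases eq_or_ne δ 0 with rfl | hδ0
    · simp
    have hz' : 0 < ‖z‖ := norm_pos_iff.2 hz
    have hd' : 0 < ‖δ‖ := norm_pos_iff.2 hδ0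
    have := this (δ := ((‖z‖ / ‖δ‖ : ℝ) : ℂ) • δ) (by rw [inner_smul_right, hδ, mul_zero])
      (by rw [norm_smul, Complex.norm_real, norm_div, norm_norm, norm_norm]; field_simp)
    rw [map_smul, norm_smul, norm_smul, mul_pow, mul_pow, mul_left_comm] at this
    exact le_of_mul_le_mul_left this (by simp; positivity)
  obtain ⟨c₁, c₂, hc, hlim⟩ := exists_tendsto_symmetrized_difference hf hμ hδ hn
  have := le_of_tendsto hlim (b := 0) <| by
    filter_upwards [nhdsWithin_le_nhds (ball_mem_nhds (0 : ℝ) one_pos)] with s hs1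
    have hs : s ^ 2 ≤ 1 := ((sq_lt_one_iff_abs_lt_one s).2 (by simpa using hs1)).le
    have key : ∀ x ∈ sphere (0 : E) ‖z‖, (‖f x‖ ^ 2 - ‖f z‖ ^ 2) / s ^ 2 ≤ 0 := fun x hx => by
      have : ‖f x‖ ≤ ‖f z‖ := hmax hx
      exact div_nonpos_of_nonpos_of_nonneg (sub_nonpos.2 (by gcongr)) (sq_nonneg s)
    exact add_nonpos (key _ (hc s hs).1) (key _ (hc s hs).2)
  linarith

theorem le_norm_fderiv_sq_of_isMinOn_sphere (hf : ∀ᶠ w in 𝓝 z, DifferentiableAt ℂ f w) {μ : ℝ}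
    (hμ : ∀ v, inner ℂ (f z) (fderiv ℂ f z v) = μ * inner ℂ z v) (hz : z ≠ 0)
    (hmin : IsMinOn (fun ξ => ‖f ξ‖) (sphere 0 ‖z‖) z) {δ : E} (hδ : inner ℂ z δ = 0) :
    μ * ‖δ‖ ^ 2 ≤ ‖fderiv ℂ f z δ‖ ^ 2 := by
  wlog hn : ‖δ‖ = ‖z‖ generalizing δ
  · rcases eq_or_ne δ 0 with rfl | hδ0
    · simp
    have hz' : 0 < ‖z‖ := norm_pos_iff.2 hz
    have hd' : 0 < ‖δ‖ := norm_pos_iff.2 hδ0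
    have := this (δ := ((‖z‖ / ‖δ‖ : ℝ) : ℂ) • δ) (by rw [inner_smul_right, hδ, mul_zero])
      (by rw [norm_smul, Complex.norm_real, norm_div, norm_norm, norm_norm]; field_simp)
    rw [map_smul, norm_smul, norm_smul, mul_pow, mul_pow, mul_left_comm] at this
    exact le_of_mul_le_mul_left this (by simp; positivity)
  obtain ⟨c₁, c₂, hc, hlim⟩ := exists_tendsto_symmetrized_difference hf hμ hδ hn
  have := ge_of_tendsto hlim (b := 0) <| by
    filter_upwards [nhdsWithin_le_nhds (ball_mem_nhds (0 : ℝ) one_pos)] with s hs1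
    have hs : s ^ 2 ≤ 1 := ((sq_lt_one_iff_abs_lt_one s).2 (by simpa using hs1)).le
    have key : ∀ x ∈ sphere (0 : E) ‖z‖, 0 ≤ (‖f x‖ ^ 2 - ‖f z‖ ^ 2) / s ^ 2 := fun x hx => by
      have : ‖f z‖ ≤ ‖f x‖ := hmin hx
      exact div_nonneg (sub_nonneg.2 (by gcongr)) (sq_nonneg s)
    exact add_nonneg (key _ (hc s hs).1) (key _ (hc s hs).2)
  linarith

end Sphere

/-! ### Subordination to `gAB A B` -/

section Subordination

variable {A B : ℝ}

theorem one_add_mul_ne_zero {C : ℝ} (hC : |C| ≤ 1) {ω : ℂ} (hω : ‖ω‖ < 1) :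
    1 + (C : ℂ) * ω ≠ 0 := by
  intro h
  have : (C : ℂ) * ω = -1 := by linear_combination h
  have h1 : ‖(C : ℂ) * ω‖ = 1 := by rw [this]; simp
  rw [norm_mul, Complex.norm_real, Real.norm_eq_abs] at h1
  nlinarith [abs_nonneg C, norm_nonneg ω]

/-- The inverse of the Möbius map `gAB A B` is `w ↦ (1 - w) / (B w - A)`. -/
theorem mul_gAB_sub (hAB : A < B) (hB : |B| ≤ 1) {ω : ℂ} (hω : ‖ω‖ < 1) :
    (B : ℂ) * gAB A B ω - A ≠ 0 ∧ (1 - gAB A B ω) / (B * gAB A B ω - A) = ω := by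
  have h := one_add_mul_ne_zero hB hω
  have hBA : (B : ℂ) - A ≠ 0 := by
    rw [← Complex.ofReal_sub]; exact_mod_cast (sub_pos.2 hAB).ne'
  have e : (B : ℂ) * gAB A B ω - A = (B - A) / (1 + B * ω) := by
    unfold gAB; field_simp; ring
  have e' : 1 - gAB A B ω = (B - A) * ω / (1 + B * ω) := by
    rw [gAB, eq_div_iff h, sub_mul, div_mul_cancel₀ _ h]; ring
  rw [e, e']
  refine ⟨div_ne_zero hBA h, by field_simp⟩

/-- The Schwarz lemma on the complex line through `z`: the value of `⟨h(z), z⟩ / ‖z‖²` lies already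
in the image under `gAB A B` of the closed disc of radius `‖z‖`. -/
theorem exists_norm_le_gAB_eq {n : ℕ} (hAB : A < B) (hB : |B| ≤ 1) {h : Cn n → Cn n}
    (hh : h ∈ Mg n (gAB A B)) {z : Cn n} (hz : z ∈ unitBall n) (hz0 : z ≠ 0) :
    ∃ ω : ℂ, ‖ω‖ ≤ ‖z‖ ∧ inner ℂ z (h z) / ((‖z‖ ^ 2 : ℝ) : ℂ) = gAB A B ω := by
  obtain ⟨hd, ⟨h0, hJ⟩, hg⟩ := hh
  have hzn : (‖z‖ : ℂ) ≠ 0 := by simpa using hz0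
  set u : Cn n := (‖z‖ : ℂ)⁻¹ • z with hu
  have hzu : z = (‖z‖ : ℂ) • u := by simp [hu, smul_smul, hzn]
  have hun : ‖u‖ = 1 := by simp [hu, norm_smul, hz0]
  have hmem : ∀ ζ ∈ ball (0 : ℂ) 1, ζ • u ∈ unitBall n := fun ζ hζ => by
    simpa [unitBall, norm_smul, hun] using hζ
  have hopen : IsOpen (unitBall n) := isOpen_ball
  have hline : ∀ ζ : ℂ, HasDerivAt (fun ζ : ℂ => ζ • u) u ζ := fun ζ => by
    simpa using (hasDerivAt_id ζ).smul_const u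
  -- `dslope φ 0` is the map `ζ ↦ ⟨h(ζu), ζu⟩ / |ζ|²`, with its singularity at `0` removed
  let φ : ℂ → ℂ := fun ζ => inner ℂ u (h (ζ • u))
  have hφ : ∀ ζ ∈ ball (0 : ℂ) 1,
      HasDerivAt φ (inner ℂ u (fderiv ℂ h (ζ • u) u)) ζ := fun ζ hζ => by
    have h1 := (hd.differentiableAt (hopen.mem_nhds (hmem ζ hζ))).hasFDerivAt
    exact (innerSL ℂ u).hasFDerivAt.comp_hasDerivAt ζ (h1.comp_hasDerivAt ζ (hline ζ))
  have hp : DifferentiableOn ℂ (dslope φ 0) (ball 0 1) :=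
    (Complex.differentiableOn_dslope (ball_mem_nhds 0 one_pos)).2
      fun ζ hζ => (hφ ζ hζ).differentiableAt.differentiableWithinAt
  have hpne : ∀ ζ : ℂ, ζ ≠ 0 →
      dslope φ 0 ζ = inner ℂ (ζ • u) (h (ζ • u)) / ((‖ζ • u‖ ^ 2 : ℝ) : ℂ) := fun ζ hζ => by
    have hcζ : (starRingEnd ℂ) ζ ≠ 0 := by simpa using hζ
    have e : ((‖ζ • u‖ ^ 2 : ℝ) : ℂ) = ζ * (starRingEnd ℂ) ζ := by
      rw [norm_smul, hun, mul_one, Complex.mul_conj, Complex.normSq_eq_norm_sq]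
    rw [dslope_of_ne _ hζ, slope_def_field, inner_smul_left, e]
    simp only [φ, zero_smul, h0, inner_zero_right, sub_zero]
    field_simp
  have hp0 : dslope φ 0 0 = 1 := by
    have hJ : fderiv ℂ h 0 = ContinuousLinearMap.id ℂ (Cn n) := hJ
    rw [dslope_same, (hφ 0 (mem_ball_self one_pos)).deriv, zero_smul, hJ,
      ContinuousLinearMap.id_apply, inner_self_eq_norm_sq_to_K, hun]
    simp
  have himg : ∀ ζ ∈ ball (0 : ℂ) 1, ∃ ω : ℂ, ‖ω‖ < 1 ∧ gAB A B ω = dslope φ 0 ζ := by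
    intro ζ hζ
    rcases eq_or_ne ζ 0 with rfl | hζ0
    · exact ⟨0, by simp, by rw [hp0]; simp [gAB]⟩
    · have hu0 : u ≠ 0 := by rw [← norm_ne_zero_iff, hun]; exact one_ne_zero
      obtain ⟨ω, hω, he⟩ := hg _ (hmem ζ hζ) (smul_ne_zero hζ0 hu0)
      exact ⟨ω, by simpa using hω, by rw [he, hpne ζ hζ0]⟩
  let W : ℂ → ℂ := fun ζ => (1 - dslope φ 0 ζ) / (B * dslope φ 0 ζ - A)
  have hW : ∀ ζ ∈ ball (0 : ℂ) 1, (B : ℂ) * dslope φ 0 ζ - A ≠ 0 ∧ ‖W ζ‖ < 1 ∧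
      gAB A B (W ζ) = dslope φ 0 ζ := by
    intro ζ hζ
    obtain ⟨ω, hω, he⟩ := himg ζ hζ
    have := mul_gAB_sub hAB hB hω
    rw [he] at this
    have e : W ζ = ω := this.2
    exact ⟨this.1, by rwa [e], by rw [e, he]⟩
  have hWd : DifferentiableOn ℂ W (ball 0 1) :=
    ((differentiableOn_const _).sub hp).div ((hp.const_mul _).sub_const _) fun ζ hζ => (hW ζ hζ).1
  have hz1 : ‖z‖ < 1 := by simpa [unitBall] using hz
  have hzb : (‖z‖ : ℂ) ∈ ball (0 : ℂ) 1 := by simpa using hz1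
  have := Complex.norm_le_norm_of_mapsTo_ball hWd
    (fun ζ hζ => by simpa using (hW ζ hζ).2.1.le)
    (by change (1 - dslope φ 0 0) / _ = 0; rw [hp0, sub_self, zero_div])
    (z := (‖z‖ : ℂ)) (by simpa using hz1)
  refine ⟨W ‖z‖, by simpa using this, ?_⟩
  rw [(hW _ hzb).2.2, hpne _ hzn, ← hzu]

/-- Since `gAB A B` has a real inverse, a real value is taken at a real point, and on the real
axis `gAB A B` is decreasing. -/
theorem bounds_of_gAB_eq_ofReal (hAB : A < B) (hB : |B| ≤ 1) {ω : ℂ} {r x : ℝ}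
    (hr : r < 1) (hω : ‖ω‖ ≤ r) (hx : gAB A B ω = x) :
    (1 + A * r) / (1 + B * r) ≤ x ∧ x ≤ (1 - A * r) / (1 - B * r) := by
  obtain ⟨h1, h2⟩ := mul_gAB_sub hAB hB (hω.trans_lt hr)
  rw [hx] at h2
  have hωt : ω = (((1 - x) / (B * x - A) : ℝ) : ℂ) := by rw [← h2]; push_cast; rfl
  set t : ℝ := (1 - x) / (B * x - A)
  rw [hωt, Complex.norm_real, Real.norm_eq_abs] at hω
  obtain ⟨ht1, ht2⟩ := abs_le.1 hω
  have hr0 : 0 ≤ r := (abs_nonneg _).trans hω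
  obtain ⟨hB1, hB2⟩ := abs_le.1 hB
  have hxt : x = (1 + A * t) / (1 + B * t) := by
    have : ((x : ℝ) : ℂ) = (((1 + A * t) / (1 + B * t) : ℝ) : ℂ) := by
      rw [← hx, hωt]; simp [gAB]
    exact_mod_cast this
  have e1 : 0 < 1 + B * t := by nlinarith [abs_lt.1 (hω.trans_lt hr)]
  have e2 : 0 < 1 + B * r := by nlinarith
  have e3 : 0 < 1 - B * r := by nlinarith
  rw [hxt, div_le_div_iff₀ e2 e1, div_le_div_iff₀ e1 e3]
  constructor <;> nlinarith

end Subordination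

/-! ### The growth function -/

/-- `∫₀ʳ (B - A) / (1 + A t) dt`, in closed form: the logarithm of the upper bound for
`‖f z‖ / ‖z‖` when `‖z‖ = r`. The lower bound has logarithm `logGrowth (-A) (-B) r`. -/
noncomputable def logGrowth (A B r : ℝ) : ℝ :=
  if A ≠ 0 then (B - A) / A * Real.log (1 + A * r) else (B - A) * r

section LogGrowth

variable {A B r : ℝ}

theorem one_add_mul_pos (hA : |A| ≤ 1) (hr0 : 0 ≤ r) (hr : r < 1) : 0 < 1 + A * r := by
  nlinarith [abs_le.1 hA]

theorem logGrowth_zero : logGrowth A B 0 = 0 := by simp [logGrowth]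

theorem hasDerivAt_logGrowth (hr : 0 < 1 + A * r) :
    HasDerivAt (logGrowth A B) ((B - A) / (1 + A * r)) r := by
  unfold logGrowth
  split_ifs with h
  · have h1 : HasDerivAt (fun r => 1 + A * r) A r := by
      simpa using ((hasDerivAt_id r).const_mul A).const_add 1
    have h2 := (h1.log hr.ne').const_mul ((B - A) / A)
    rw [div_mul_div_cancel₀ h] at h2
    simpa only [ne_eq, h, not_false_eq_true, if_true] using h2
  · have h : A = 0 := not_not.1 h
    subst h
    simpa using (hasDerivAt_id r).const_mul (B - 0)

theorem exp_logGrowth_pow (hr : 0 < 1 + A * r) (k : ℕ) :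
    Real.exp (logGrowth A B r) ^ k =
      if A ≠ 0 then (1 + A * r) ^ ((k : ℝ) * (B - A) / A) else Real.exp ((k : ℝ) * (B - A) * r) := by
  rw [← Real.exp_nat_mul]
  unfold logGrowth
  split_ifs with h
  · rw [Real.rpow_def_of_pos hr]; congr 1; ring
  · congr 1; ring

end LogGrowth

/-! ### Growth estimates -/

section Radial

variable {E F : Type*} [NormedAddCommGroup E] [InnerProductSpace ℂ E]
  [NormedAddCommGroup F] [InnerProductSpace ℂ F] {f : E → F} {z : E}

theorem hasDerivAt_log_norm_radial (hf : DifferentiableAt ℂ f z) (hfz : f z ≠ 0) {μ : ℝ}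
    (hμ : ∀ v, inner ℂ (f z) (fderiv ℂ f z v) = μ * inner ℂ z v) :
    HasDerivAt (fun t : ℝ => Real.log ‖f (t • z)‖) (μ * ‖z‖ ^ 2 / ‖f z‖ ^ 2) 1 := by
  let _ : InnerProductSpace ℝ F := InnerProductSpace.rclikeToReal ℂ F
  have h1 : HasDerivAt (fun t : ℝ => t • z) z 1 := by
    simpa using (hasDerivAt_id (1 : ℝ)).smul_const z
  have h2 : HasFDerivAt f ((fderiv ℂ f z).restrictScalars ℝ) ((1 : ℝ) • z) := by
    rw [one_smul]; exact hf.hasFDerivAt.restrictScalars ℝ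
  have h3 := (h2.comp_hasDerivAt 1 h1).norm_sq
  have h4 := (h3.log (by simpa using hfz)).const_mul (1 / 2)
  have e : (inner ℂ z z).re = ‖z‖ ^ 2 := inner_self_eq_norm_sq (𝕜 := ℂ) z
  have e2 : inner ℝ (f z) (fderiv ℂ f z z) = μ * ‖z‖ ^ 2 := by
    rw [real_inner_eq_re_inner ℂ]
    change (inner ℂ (f z) (fderiv ℂ f z z)).re = _
    rw [hμ, Complex.re_ofReal_mul, e]
  simp only [Function.comp_apply, one_smul, ContinuousLinearMap.coe_restrictScalars', e2] at h4
  refine (h4.congr_deriv (by ring)).congr_of_eventuallyEq (.of_forall fun t => ?_)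
  simp only [Real.log_pow]
  push_cast
  ring

theorem nonneg_of_hasDerivAt_of_forall_le {ψ : ℝ → ℝ} {d : ℝ} (h : HasDerivAt ψ d 1)
    (hle : ∀ t, 0 < t → t < 1 → ψ t ≤ ψ 1) : 0 ≤ d := by
  have h1 : Tendsto (slope ψ 1) (𝓝[<] 1) (𝓝 d) :=
    (hasDerivAt_iff_tendsto_slope.1 h).mono_left (nhdsWithin_mono 1 fun t ht => ne_of_lt ht)
  refine ge_of_tendsto h1 ?_
  filter_upwards [Ioo_mem_nhdsLT (show (0 : ℝ) < 1 by norm_num)] with t ht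
  rw [slope_def_field]
  exact div_nonneg_of_nonpos (sub_nonpos.2 (hle t ht.1 ht.2)) (by linarith [ht.2])

end Radial

section Growth

variable {n : ℕ} {f : Cn n → Cn n}

theorem LS.differentiableAt (hf : f ∈ LS n) {z : Cn n} (hz : z ∈ unitBall n) :
    DifferentiableAt ℂ f z :=
  DifferentiableOn.differentiableAt hf.1 (isOpen_ball.mem_nhds hz)

theorem LS.eventually_differentiableAt (hf : f ∈ LS n) {z : Cn n} (hz : z ∈ unitBall n) :
    ∀ᶠ w in 𝓝 z, DifferentiableAt ℂ f w := by
  filter_upwards [isOpen_ball.mem_nhds hz] with w hw using LS.differentiableAt hf hw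

theorem LS.tendsto_norm_div_norm (hf : f ∈ LS n) :
    Tendsto (fun w => ‖f w‖ / ‖w‖) (𝓝[≠] 0) (𝓝 1) := by
  have h0 : (0 : Cn n) ∈ unitBall n := mem_ball_self one_pos
  have h1 := (LS.differentiableAt hf h0).hasFDerivAt
  have hJ : fderiv ℂ f 0 = ContinuousLinearMap.id ℂ (Cn n) := hf.2.1.2
  have hf0 : f 0 = 0 := hf.2.1.1
  rw [hJ, hasFDerivAt_iff_tendsto] at h1
  simp only [hf0, sub_zero, ContinuousLinearMap.id_apply] at h1
  rw [tendsto_iff_dist_tendsto_zero]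
  refine squeeze_zero' (.of_forall fun _ => dist_nonneg) ?_ (h1.mono_left nhdsWithin_le_nhds)
  filter_upwards [self_mem_nhdsWithin] with w hw
  have hw : 0 < ‖w‖ := norm_pos_iff.2 hw
  rw [Real.dist_eq, div_sub_one hw.ne', abs_div, abs_norm, div_eq_inv_mul]
  gcongr
  exact abs_norm_sub_norm_le _ _

/-- At the origin the junk values `0 / 0 = 0` and `log 0 = 0` give the correct limit `log 1 = 0`. -/
theorem LS.continuousOn_log_norm_div_norm (hf : f ∈ LS n)
    (hne : ∀ w ∈ unitBall n, w ≠ 0 → f w ≠ 0) :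
    ContinuousOn (fun w => Real.log (‖f w‖ / ‖w‖)) (unitBall n) := by
  intro w hw
  refine ContinuousAt.continuousWithinAt ?_
  rcases eq_or_ne w 0 with rfl | hw0
  · rw [continuousAt_iff_punctured_nhds]
    simpa [Function.comp_def] using
      (Real.continuousAt_log one_ne_zero).tendsto.comp (LS.tendsto_norm_div_norm hf)
  · have := (LS.differentiableAt hf hw).continuousAt
    refine (this.norm.div continuousAt_id.norm (by simpa using hw0)).log ?_
    exact div_ne_zero (by simpa using hne w hw hw0) (by simpa using hw0)

/-- A comparison principle, used with `σ = 1` for upper and `σ = -1` for lower bounds. Consider a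
maximum point `w` of `σ (log (‖f w‖ / ‖w‖) - logGrowth A B ‖w‖) - ε ‖w‖` over a closed ball. If
`w ≠ 0`, then `w` is extremal for `‖f‖` on its sphere, and there the bound on the multiplier makes
the outward radial derivative negative, which is impossible at a maximum. So the maximum is the
value `0` at the origin. The term `ε ‖w‖` makes the inequality strict. -/
theorem LS.log_norm_div_norm_le (hf : f ∈ LS n) (hne : ∀ w ∈ unitBall n, w ≠ 0 → f w ≠ 0)
    {A B σ : ℝ} (hA : |A| ≤ 1)
    (hcrit : ∀ w ∈ unitBall n, w ≠ 0 →
      (∀ ξ ∈ sphere (0 : Cn n) ‖w‖, σ * Real.log ‖f ξ‖ ≤ σ * Real.log ‖f w‖) →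
      ∃ μ : ℝ, (∀ v, inner ℂ (f w) (fderiv ℂ f w v) = μ * inner ℂ w v) ∧
        σ * (μ * ‖w‖ ^ 2 / ‖f w‖ ^ 2) ≤ σ * ((1 + B * ‖w‖) / (1 + A * ‖w‖)))
    {z : Cn n} (hz : z ∈ unitBall n) :
    σ * Real.log (‖f z‖ / ‖z‖) ≤ σ * logGrowth A B ‖z‖ := by
  have hsub : closedBall (0 : Cn n) ‖z‖ ⊆ unitBall n :=
    closedBall_subset_ball (by simpa [unitBall] using hz)
  suffices h : ∀ ε > 0, σ * (Real.log (‖f z‖ / ‖z‖) - logGrowth A B ‖z‖) - ε * ‖z‖ ≤ 0 by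
    have : σ * (Real.log (‖f z‖ / ‖z‖) - logGrowth A B ‖z‖) ≤ 0 := by
      refine le_of_forall_pos_le_add fun ε hε => ?_
      have hz1 : ‖z‖ < 1 := by simpa [unitBall] using hz
      nlinarith [h ε hε]
    linarith
  intro ε hε
  let Ψ : Cn n → ℝ := fun w =>
    σ * (Real.log (‖f w‖ / ‖w‖) - logGrowth A B ‖w‖) - ε * ‖w‖
  have hΨ : ContinuousOn Ψ (closedBall 0 ‖z‖) := by
    have h1 := (LS.continuousOn_log_norm_div_norm hf hne).mono hsub
    have h2 : ContinuousOn (fun w : Cn n => logGrowth A B ‖w‖) (closedBall 0 ‖z‖) := by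
      intro w hw
      have hw1 : ‖w‖ < 1 := by simpa [unitBall] using hsub hw
      have := (hasDerivAt_logGrowth (B := B) (one_add_mul_pos hA (norm_nonneg w) hw1)).continuousAt
      exact (this.comp continuousAt_id.norm).continuousWithinAt
    exact ((h1.sub h2).const_smul σ).sub (by fun_prop)
  obtain ⟨w, hw, hmax⟩ := (isCompact_closedBall (0 : Cn n) ‖z‖).exists_isMaxOn
    ⟨0, mem_closedBall_self (norm_nonneg z)⟩ hΨ
  have hzw : Ψ z ≤ Ψ w := hmax (by simp)
  rcases eq_or_ne w 0 with rfl | hw0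
  · simpa [Ψ, logGrowth_zero] using hzw
  exfalso
  have hwz : ‖w‖ ≤ ‖z‖ := by simpa using hw
  have hwb := hsub hw
  have hw1 : ‖w‖ < 1 := by simpa [unitBall] using hwb
  have hwp : 0 < ‖w‖ := norm_pos_iff.2 hw0
  have hfw := hne w hwb hw0
  obtain ⟨μ, hμ, hle⟩ := hcrit w hwb hw0 fun ξ hξ => by
    have hξn : ‖ξ‖ = ‖w‖ := by simpa using hξ
    have hξ0 : ξ ≠ 0 := by rw [← norm_pos_iff, hξn]; exact hwp
    have hξb : ξ ∈ closedBall (0 : Cn n) ‖z‖ := by simpa [hξn] using hwz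
    have := hmax hξb
    simp only [Ψ, Set.mem_ofPred_eq, hξn] at this
    rw [Real.log_div (by simpa using hne ξ (hsub hξb) hξ0) hwp.ne',
      Real.log_div (by simpa using hfw) hwp.ne'] at this
    linarith
  have hApos := one_add_mul_pos hA (norm_nonneg w) hw1
  have hd1 := hasDerivAt_log_norm_radial (LS.differentiableAt hf hwb) hfw hμ
  have hd2 : HasDerivAt (fun t : ℝ => Real.log t) 1 1 := by
    simpa using Real.hasDerivAt_log (one_ne_zero (α := ℝ))
  have hmul : HasDerivAt (fun t : ℝ => t * ‖w‖) ‖w‖ 1 := by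
    simpa using (hasDerivAt_id (1 : ℝ)).mul_const ‖w‖
  have hd3 : HasDerivAt (fun t : ℝ => logGrowth A B (t * ‖w‖))
      ((B - A) / (1 + A * ‖w‖) * ‖w‖) 1 := by
    have h1 : HasDerivAt (logGrowth A B) ((B - A) / (1 + A * ‖w‖)) (1 * ‖w‖) := by
      rw [one_mul]
      exact hasDerivAt_logGrowth hApos
    exact h1.comp (1 : ℝ) hmul
  have hd := ((((hd1.sub (hd2.add_const (Real.log ‖w‖))).sub hd3).const_mul σ).sub
    (hmul.const_mul ε))
  have hΨt : ∀ t : ℝ, 0 < t → t ≤ 1 → Ψ (t • w) =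
      σ * (Real.log ‖f (t • w)‖ - (Real.log t + Real.log ‖w‖) - logGrowth A B (t * ‖w‖)) -
        ε * (t * ‖w‖) := by
    intro t ht ht1
    have hn : ‖t • w‖ = t * ‖w‖ := by rw [norm_smul, Real.norm_eq_abs, abs_of_pos ht]
    have hb : t • w ∈ unitBall n := by
      simp only [unitBall, mem_ball_zero_iff, hn]; nlinarith
    have := hne _ hb (smul_ne_zero ht.ne' hw0)
    simp only [Ψ, hn]
    rw [Real.log_div (by simpa using this) (by positivity), Real.log_mul ht.ne' hwp.ne']
  have := nonneg_of_hasDerivAt_of_forall_le hd fun t ht ht1 => by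
    have h1 := hΨt 1 one_pos le_rfl
    have h2 := hΨt t ht ht1.le
    have hb : t • w ∈ closedBall (0 : Cn n) ‖z‖ := by
      rw [mem_closedBall_zero_iff, norm_smul, Real.norm_eq_abs, abs_of_pos ht]; nlinarith
    have h3 : Ψ (t • w) ≤ Ψ ((1 : ℝ) • w) := by rw [one_smul]; exact hmax hb
    rw [h1, h2] at h3
    exact h3
  have e : (1 + B * ‖w‖) / (1 + A * ‖w‖) - 1 - (B - A) / (1 + A * ‖w‖) * ‖w‖ = 0 := by
    rw [div_mul_eq_mul_div, div_sub_one hApos.ne', ← sub_div]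
    ring_nf
  have : σ * ((1 + B * ‖w‖) / (1 + A * ‖w‖)) = σ * (1 + (B - A) / (1 + A * ‖w‖) * ‖w‖) := by
    congr 1; linarith
  nlinarith [mul_pos hε hwp]

end Growth

/-! ### Distortion of `g`-starlike maps -/

section Starlike

variable {n : ℕ} {f : Cn n → Cn n} {A B : ℝ}

theorem StarlikeClass.ne_zero (hA : |A| ≤ 1) (hB : |B| ≤ 1) (hf : f ∈ StarlikeClass n (gAB A B))
    {z : Cn n} (hz : z ∈ unitBall n) (hz0 : z ≠ 0) : f z ≠ 0 := by
  intro h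
  obtain ⟨ω, hω, he⟩ := hf.2.2.2 z hz hz0
  have hω : ‖ω‖ < 1 := by simpa using hω
  simp only [h, map_zero, inner_zero_right, zero_div] at he
  exact div_ne_zero (one_add_mul_ne_zero hA hω) (one_add_mul_ne_zero hB hω) he

/-- Testing `Df(z)† f(z) = μ z` against `h(z) = Df(z)⁻¹ f(z)` gives `‖f(z)‖² = μ ⟨h(z), z⟩`. So
`⟨h(z), z⟩ / ‖z‖²` is real, and subordination confines it to an interval. -/
theorem StarlikeClass.multiplier_bounds (hA : |A| ≤ 1) (hB : |B| ≤ 1) (hAB : A < B)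
    (hf : f ∈ StarlikeClass n (gAB A B)) {z : Cn n} (hz : z ∈ unitBall n) (hz0 : z ≠ 0) {μ : ℝ}
    (hμ : ∀ v, inner ℂ (f z) (fderiv ℂ f z v) = μ * inner ℂ z v) :
    0 < μ ∧ (1 - B * ‖z‖) / (1 - A * ‖z‖) ≤ μ * ‖z‖ ^ 2 / ‖f z‖ ^ 2 ∧
      μ * ‖z‖ ^ 2 / ‖f z‖ ^ 2 ≤ (1 + B * ‖z‖) / (1 + A * ‖z‖) := by
  have hfz := StarlikeClass.ne_zero hA hB hf hz hz0
  have hfp : 0 < ‖f z‖ := norm_pos_iff.2 hfz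
  have hzp : 0 < ‖z‖ := norm_pos_iff.2 hz0
  have hz1 : ‖z‖ < 1 := by simpa [unitBall] using hz
  have hJ : fderiv ℂ f z ((J f z).inverse (f z)) = f z := (hf.1.2.2 z hz).self_apply_inverse _
  have h1 := hμ ((J f z).inverse (f z))
  rw [hJ, inner_self_eq_norm_sq_to_K] at h1
  have hμ0 : (μ : ℂ) ≠ 0 := by
    intro h
    rw [h, zero_mul] at h1
    simp [hfz] at h1
  have hμ0' : μ ≠ 0 := by exact_mod_cast hμ0
  obtain ⟨ω, hω, he⟩ := exists_norm_le_gAB_eq hAB hB hf.2 hz hz0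
  have hx : gAB A B ω = ((‖f z‖ ^ 2 / (μ * ‖z‖ ^ 2) : ℝ) : ℂ) := by
    have hzc : (‖z‖ : ℂ) ≠ 0 := by exact_mod_cast hzp.ne'
    rw [← he]
    push_cast
    rw [div_eq_div_iff (pow_ne_zero 2 hzc) (mul_ne_zero hμ0 (pow_ne_zero 2 hzc))]
    linear_combination -(‖z‖ : ℂ) ^ 2 * h1
  obtain ⟨hl, hu⟩ := bounds_of_gAB_eq_ofReal hAB hB hz1 hω hx
  have p1 := one_add_mul_pos hA hzp.le hz1
  have p2 := one_add_mul_pos hB hzp.le hz1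
  have p3 := one_add_mul_pos (A := -A) (by rwa [abs_neg]) hzp.le hz1
  have p4 := one_add_mul_pos (A := -B) (by rwa [abs_neg]) hzp.le hz1
  have p3 : 0 < 1 - A * ‖z‖ := by linarith
  have p4 : 0 < 1 - B * ‖z‖ := by linarith
  have hq : 0 < ‖f z‖ ^ 2 / (μ * ‖z‖ ^ 2) := lt_of_lt_of_le (by positivity) hl
  have hμp : 0 < μ := by
    rw [div_pos_iff_of_pos_left (by positivity)] at hq
    exact pos_of_mul_pos_left hq (by positivity)
  refine ⟨hμp, ?_, ?_⟩
  · rw [← inv_le_inv₀ (by positivity) (by positivity), inv_div, inv_div]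
    exact hu
  · rw [← inv_le_inv₀ (by positivity) (by positivity), inv_div, inv_div]
    exact hl

theorem StarlikeClass.exists_multiplier (hf : f ∈ StarlikeClass n (gAB A B)) {z : Cn n}
    (hz : z ∈ unitBall n) (hz0 : z ≠ 0)
    (hext : IsExtrOn (fun ξ => ‖f ξ‖) (sphere 0 ‖z‖) z) :
    ∃ μ : ℝ, ∀ v, inner ℂ (f z) (fderiv ℂ f z v) = μ * inner ℂ z v :=
  exists_multiplier_of_isExtrOn_sphere (LS.eventually_differentiableAt hf.1 hz) hz0 hext

theorem StarlikeClass.ne_zero_of_mem_sphere (hA : |A| ≤ 1) (hB : |B| ≤ 1)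
    (hf : f ∈ StarlikeClass n (gAB A B)) {z ξ : Cn n} (hz : z ∈ unitBall n) (hz0 : z ≠ 0)
    (hξ : ξ ∈ sphere (0 : Cn n) ‖z‖) : f ξ ≠ 0 := by
  have hξ : ‖ξ‖ = ‖z‖ := by simpa using hξ
  refine StarlikeClass.ne_zero hA hB hf ?_ ?_
  · simpa [unitBall, hξ] using hz
  · rw [← norm_pos_iff, hξ]; exact norm_pos_iff.2 hz0

theorem StarlikeClass.norm_div_norm_le (hA : |A| ≤ 1) (hB : |B| ≤ 1) (hAB : A < B)
    (hf : f ∈ StarlikeClass n (gAB A B)) {z : Cn n} (hz : z ∈ unitBall n) (hz0 : z ≠ 0) :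
    ‖f z‖ / ‖z‖ ≤ Real.exp (logGrowth A B ‖z‖) := by
  have hpos : 0 < ‖f z‖ / ‖z‖ :=
    div_pos (norm_pos_iff.2 (StarlikeClass.ne_zero hA hB hf hz hz0)) (norm_pos_iff.2 hz0)
  rw [← Real.log_le_iff_le_exp hpos]
  have := LS.log_norm_div_norm_le (A := A) (B := B) (σ := 1) hf.1
    (fun w hw hw0 => StarlikeClass.ne_zero hA hB hf hw hw0) hA (fun w hw hw0 hmax => ?_) hz
  · simpa using this
  · obtain ⟨μ, hμ⟩ := StarlikeClass.exists_multiplier hf hw hw0 <| Or.inr fun ξ hξ => by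
      have := hmax ξ hξ
      rw [one_mul, one_mul] at this
      exact (Real.log_le_log_iff
        (norm_pos_iff.2 (StarlikeClass.ne_zero_of_mem_sphere hA hB hf hw hw0 hξ))
        (norm_pos_iff.2 (StarlikeClass.ne_zero hA hB hf hw hw0))).1 this
    refine ⟨μ, hμ, ?_⟩
    rw [one_mul, one_mul]
    exact (StarlikeClass.multiplier_bounds hA hB hAB hf hw hw0 hμ).2.2

theorem StarlikeClass.le_norm_div_norm (hA : |A| ≤ 1) (hB : |B| ≤ 1) (hAB : A < B)
    (hf : f ∈ StarlikeClass n (gAB A B)) {z : Cn n} (hz : z ∈ unitBall n) (hz0 : z ≠ 0) :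
    Real.exp (logGrowth (-A) (-B) ‖z‖) ≤ ‖f z‖ / ‖z‖ := by
  have hpos : 0 < ‖f z‖ / ‖z‖ :=
    div_pos (norm_pos_iff.2 (StarlikeClass.ne_zero hA hB hf hz hz0)) (norm_pos_iff.2 hz0)
  rw [← Real.le_log_iff_exp_le hpos]
  have := LS.log_norm_div_norm_le (A := -A) (B := -B) (σ := -1) hf.1
    (fun w hw hw0 => StarlikeClass.ne_zero hA hB hf hw hw0) (by rwa [abs_neg])
    (fun w hw hw0 hmax => ?_) hz
  · linarith
  · obtain ⟨μ, hμ⟩ := StarlikeClass.exists_multiplier hf hw hw0 <| Or.inl fun ξ hξ => by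
      have := hmax ξ hξ
      exact (Real.log_le_log_iff
        (norm_pos_iff.2 (StarlikeClass.ne_zero hA hB hf hw hw0))
        (norm_pos_iff.2 (StarlikeClass.ne_zero_of_mem_sphere hA hB hf hw hw0 hξ))).1 (by linarith)
    refine ⟨μ, hμ, ?_⟩
    have := (StarlikeClass.multiplier_bounds hA hB hAB hf hw hw0 hμ).2.1
    rw [neg_mul B, neg_mul A, ← sub_eq_add_neg, ← sub_eq_add_neg]
    linarith

theorem StarlikeClass.distortion_of_isMaxOn (hA : |A| ≤ 1) (hB : |B| ≤ 1) (hAB : A < B)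
    (hf : f ∈ StarlikeClass n (gAB A B)) {z : Cn n} (hz : z ∈ unitBall n) (hz0 : z ≠ 0)
    (hmax : IsMaxOn (fun ξ => ‖f ξ‖) (sphere 0 ‖z‖) z) :
    ‖(J f z).det‖ ≤ Real.exp (logGrowth A B ‖z‖) ^ n *
        √((1 + B * ‖z‖) / (1 + A * ‖z‖)) ^ (n + 1) ∧
      ∀ δ ∈ holTangent z, ‖J f z δ‖ ≤
        Real.exp (logGrowth A B ‖z‖) * √((1 + B * ‖z‖) / (1 + A * ‖z‖)) * ‖δ‖ := by
  obtain ⟨μ, hμ⟩ := StarlikeClass.exists_multiplier hf hz hz0 (Or.inr hmax)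
  obtain ⟨hμ0, -, hle⟩ := StarlikeClass.multiplier_bounds hA hB hAB hf hz hz0 hμ
  have hgr := StarlikeClass.norm_div_norm_le hA hB hAB hf hz hz0
  have hfz := StarlikeClass.ne_zero hA hB hf hz hz0
  have hfp : 0 < ‖f z‖ := norm_pos_iff.2 hfz
  have hzp : 0 < ‖z‖ := norm_pos_iff.2 hz0
  have hT : ∀ δ, inner ℂ z δ = 0 → ‖fderiv ℂ f z δ‖ ^ 2 ≤ μ * ‖δ‖ ^ 2 := fun δ hδ =>
    norm_fderiv_sq_le_of_isMaxOn_sphere (LS.eventually_differentiableAt hf.1 hz) hμ hz0 hmax hδ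
  set Λ := (1 + B * ‖z‖) / (1 + A * ‖z‖)
  set G := Real.exp (logGrowth A B ‖z‖)
  have hsqrt : √μ ≤ ‖f z‖ / ‖z‖ * √Λ := by
    rw [Real.sqrt_le_left (by positivity), mul_pow, Real.sq_sqrt (le_trans (by positivity) hle)]
    rw [div_le_iff₀ (by positivity)] at hle
    rw [div_pow, div_mul_eq_mul_div, le_div_iff₀ (by positivity)]
    linarith
  constructor
  · have h1 := norm_det_mul_norm_le (T := (fderiv ℂ f z : Cn n →ₗ[ℂ] Cn n))
      (a := (J f z).inverse (f z)) hμ0 hz0 hfz ((hf.1.2.2 z hz).self_apply_inverse _) hμ hT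
    rw [finrank_euclideanSpace_fin] at h1
    have h2 : ‖(J f z).det‖ * ‖f z‖ ≤ (‖f z‖ / ‖z‖ * √Λ) ^ (n + 1) * ‖z‖ := h1.trans (by gcongr)
    rw [← le_div_iff₀ hfp] at h2
    calc _ ≤ _ := h2
      _ = (‖f z‖ / ‖z‖) ^ n * √Λ ^ (n + 1) := by rw [mul_pow, pow_succ (‖f z‖ / ‖z‖)]; field_simp
      _ ≤ _ := by gcongr
  · intro δ hδ
    have h1 : ‖J f z δ‖ ≤ √μ * ‖δ‖ := by
      refine le_of_sq_le_sq ?_ (by positivity)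
      rw [mul_pow, Real.sq_sqrt hμ0.le]
      exact hT δ hδ
    exact h1.trans (by gcongr; exact hsqrt.trans (by gcongr))

theorem StarlikeClass.distortion_of_isMinOn (hA : |A| ≤ 1) (hB : |B| ≤ 1) (hAB : A < B)
    (hf : f ∈ StarlikeClass n (gAB A B)) {z : Cn n} (hz : z ∈ unitBall n) (hz0 : z ≠ 0)
    (hmin : IsMinOn (fun ξ => ‖f ξ‖) (sphere 0 ‖z‖) z) :
    Real.exp (logGrowth (-A) (-B) ‖z‖) ^ n *
        √((1 - B * ‖z‖) / (1 - A * ‖z‖)) ^ (n + 1) ≤ ‖(J f z).det‖ ∧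
      ∀ δ ∈ holTangent z, Real.exp (logGrowth (-A) (-B) ‖z‖) *
        √((1 - B * ‖z‖) / (1 - A * ‖z‖)) * ‖δ‖ ≤ ‖J f z δ‖ := by
  obtain ⟨μ, hμ⟩ := StarlikeClass.exists_multiplier hf hz hz0 (Or.inl hmin)
  obtain ⟨hμ0, hle, -⟩ := StarlikeClass.multiplier_bounds hA hB hAB hf hz hz0 hμ
  have hgr := StarlikeClass.le_norm_div_norm hA hB hAB hf hz hz0
  have hfz := StarlikeClass.ne_zero hA hB hf hz hz0
  have hfp : 0 < ‖f z‖ := norm_pos_iff.2 hfz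
  have hzp : 0 < ‖z‖ := norm_pos_iff.2 hz0
  have hT : ∀ δ, inner ℂ z δ = 0 → μ * ‖δ‖ ^ 2 ≤ ‖fderiv ℂ f z δ‖ ^ 2 := fun δ hδ =>
    le_norm_fderiv_sq_of_isMinOn_sphere (LS.eventually_differentiableAt hf.1 hz) hμ hz0 hmin hδ
  set Λ := (1 - B * ‖z‖) / (1 - A * ‖z‖)
  set G := Real.exp (logGrowth (-A) (-B) ‖z‖)
  have hsqrt : ‖f z‖ / ‖z‖ * √Λ ≤ √μ := by
    refine Real.le_sqrt_of_sq_le ?_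
    rcases le_or_gt 0 Λ with hΛ | hΛ
    · rw [mul_pow, Real.sq_sqrt hΛ]
      rw [le_div_iff₀ (by positivity)] at hle
      rw [div_pow, div_mul_eq_mul_div, div_le_iff₀ (by positivity)]
      linarith
    · rw [Real.sqrt_eq_zero_of_nonpos hΛ.le, mul_zero, sq, zero_mul]
      exact hμ0.le
  constructor
  · have h1 := le_norm_det_mul_norm (T := (fderiv ℂ f z : Cn n →ₗ[ℂ] Cn n))
      (a := (J f z).inverse (f z)) hμ0 hz0 hfz ((hf.1.2.2 z hz).self_apply_inverse _) hμ hT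
    rw [finrank_euclideanSpace_fin] at h1
    have h2 : (‖f z‖ / ‖z‖ * √Λ) ^ (n + 1) * ‖z‖ ≤ ‖(J f z).det‖ * ‖f z‖ :=
      le_trans (by gcongr) h1
    rw [← div_le_iff₀ hfp] at h2
    calc _ ≤ (‖f z‖ / ‖z‖) ^ n * √Λ ^ (n + 1) := by gcongr
      _ = _ := by rw [mul_pow, pow_succ (‖f z‖ / ‖z‖)]; field_simp
      _ ≤ _ := h2
  · intro δ hδ
    have h1 : √μ * ‖δ‖ ≤ ‖J f z δ‖ := by
      refine le_of_sq_le_sq ?_ (by positivity)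
      rw [mul_pow, Real.sq_sqrt hμ0.le]
      exact hT δ hδ
    refine le_trans ?_ h1
    gcongr
    exact le_trans (by gcongr) hsqrt

end Starlike

theorem sqrt_pow_succ_eq_rpow {x : ℝ} (hx : 0 ≤ x) (n : ℕ) :
    √x ^ (n + 1) = x ^ (((n : ℝ) + 1) / 2) := by
  rw [Real.sqrt_eq_rpow, ← Real.rpow_natCast, ← Real.rpow_mul hx]
  congr 1; push_cast; ring

end GStarlike

theorem corollary3p5 (n : ℕ) (A B : ℝ) (hA : -1 ≤ A) (hAB : A < B) (hB : B ≤ 1)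
    (f : GStarlike.Cn n → GStarlike.Cn n)
    (hf : f ∈ GStarlike.StarlikeClass n (GStarlike.gAB A B))
    (z : GStarlike.Cn n) (hz : z ∈ GStarlike.unitBall n) (hz0 : z ≠ 0) :
    (IsMaxOn (fun ξ => ‖f ξ‖) (Metric.sphere 0 ‖z‖) z →
      ‖(GStarlike.J f z).det‖ ≤
          (if A ≠ 0 then (1 + A * ‖z‖) ^ ((n : ℝ) * (B - A) / A)
            else Real.exp ((n : ℝ) * (B - A) * ‖z‖)) *
          ((1 + B * ‖z‖) / (1 + A * ‖z‖)) ^ (((n : ℝ) + 1) / 2) ∧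
      ∀ δ ∈ GStarlike.holTangent z,
        ‖GStarlike.J f z δ‖ ≤
          (if A ≠ 0 then (1 + A * ‖z‖) ^ ((B - A) / A)
            else Real.exp ((B - A) * ‖z‖)) *
          ((1 + B * ‖z‖) / (1 + A * ‖z‖)) ^ ((1 : ℝ) / 2) * ‖δ‖) ∧
    (IsMinOn (fun ξ => ‖f ξ‖) (Metric.sphere 0 ‖z‖) z →
      (if A ≠ 0 then (1 - A * ‖z‖) ^ ((n : ℝ) * (A - B) / (-A))
          else Real.exp ((n : ℝ) * (A - B) * ‖z‖)) *
          ((1 - A * ‖z‖) / (1 - B * ‖z‖)) ^ (-(((n : ℝ) + 1) / 2)) ≤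
        ‖(GStarlike.J f z).det‖ ∧
      ∀ δ ∈ GStarlike.holTangent z,
        (if A ≠ 0 then (1 - A * ‖z‖) ^ ((A - B) / (-A))
            else Real.exp ((A - B) * ‖z‖)) *
          ((1 - A * ‖z‖) / (1 - B * ‖z‖)) ^ (-((1 : ℝ) / 2)) * ‖δ‖ ≤
        ‖GStarlike.J f z δ‖) := by
  have hA' : |A| ≤ 1 := abs_le.2 ⟨hA, by linarith⟩
  have hB' : |B| ≤ 1 := abs_le.2 ⟨by linarith, hB⟩
  have hzp : 0 < ‖z‖ := norm_pos_iff.2 hz0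
  have hz1 : ‖z‖ < 1 := by simpa [GStarlike.unitBall] using hz
  have p1 := GStarlike.one_add_mul_pos hA' hzp.le hz1
  have p2 := GStarlike.one_add_mul_pos hB' hzp.le hz1
  have q3 := GStarlike.one_add_mul_pos (A := -A) (by rwa [abs_neg]) hzp.le hz1
  have q4 := GStarlike.one_add_mul_pos (A := -B) (by rwa [abs_neg]) hzp.le hz1
  have p3 : 0 < 1 - A * ‖z‖ := by linarith
  have p4 : 0 < 1 - B * ‖z‖ := by linarith
  refine ⟨fun hmax => ?_, fun hmin => ?_⟩
  · have e1 := GStarlike.exp_logGrowth_pow (B := B) p1 1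
    rw [pow_one, Nat.cast_one, one_mul] at e1
    rw [← GStarlike.exp_logGrowth_pow p1, ← GStarlike.sqrt_pow_succ_eq_rpow (by positivity), ← e1,
      ← Real.sqrt_eq_rpow]
    exact GStarlike.StarlikeClass.distortion_of_isMaxOn hA' hB' hAB hf hz hz0 hmax
  · have e := fun k => GStarlike.exp_logGrowth_pow (B := -B) q3 k
    simp only [ne_eq, neg_eq_zero, neg_mul, ← sub_eq_add_neg,
      show -B - -A = A - B by ring] at e
    have e1 := e 1
    rw [pow_one, Nat.cast_one, one_mul] at e1
    rw [Real.rpow_neg (by positivity), ← Real.inv_rpow (by positivity), inv_div,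
      ← GStarlike.sqrt_pow_succ_eq_rpow (by positivity), Real.rpow_neg (by positivity),
      ← Real.inv_rpow (by positivity), inv_div, ← Real.sqrt_eq_rpow]
    simp only [ne_eq]
    rw [← e, ← e1]
    exact GStarlike.StarlikeClass.distortion_of_isMinOn hA' hB' hAB hf hz hz0 hmin
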